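/- For real $x>-1$ let $$K(x)=\int_0^\infty e^{-t}\,\frac{t^x-1}{t-1}\,dt$$ be the Kurepa function. The integral converges absolutely for every $x>-1$, $K$ is differentiable at $0$, and for all $x\in[0,1]$ $$K(x)\le K'(0)\,x .$$ The constant $K'(0)$ is best possible: if $c\in\mathbb{R}$ satisfies $K(x)\le c\,x$ for all $x\in[0,1]$, then $K'(0)\le c$. Numerically, $K'(0)\approx 1.432205735$ to nine decimal places, i.e. $|K'(0)-1.432205735|<5\cdot 10^{-10}$. -/

import Mathlib

/-- The integrand of the Kurepa function, used for `t > 0`. (At the single point `t = 1` the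
quotient has the junk value `0`, which does not affect the integral.) -/
noncomputable def kurepaIntegrand (x t : ℝ) : ℝ :=
  Real.exp (-t) * ((t ^ x - 1) / (t - 1))

/-- The Kurepa function `K(x) = ∫_0^∞ e^{-t} (t^x - 1) / (t - 1) dt` of a real argument; the
integral converges for `x > -1`, hence on a neighbourhood of `[0, 1]`. -/
noncomputable def kurepa (x : ℝ) : ℝ :=
  ∫ t in Set.Ioi (0 : ℝ), kurepaIntegrand x t

/-!
Write `f t = log t / (t - 1)`, extended by `f 1 = 1` (`logSlope`). Differentiating under the integral
sign gives `K'(0) = ∫₀^∞ e^{-t} f t dt`.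

**The inequality.** For `x ∈ [0, 1]` and every `t > 0`,
`(t^x - 1) / (t - 1) ≤ x f t + x² (1 - f t)`, a consequence of the convexity of `exp`
(`rpow_sub_one_div_le`). Integrating against `e^{-t}` yields `K(x) ≤ K'(0) x - (K'(0) - 1) x²`
(`kurepa_le`), which is at most `K'(0) x` because `K'(0) > 1`. Optimality of the constant is the
definition of the derivative, as `K(0) = 0`.

**The numerical value.** The constant has the closed form
`e K'(0) = γ²/2 + 5π²/12 + ∑_{k ≥ 1} (γ - 1/k) / (k k!)`.
The Laplace transform `Φ(y) = ∫₀^∞ e^{-yt} f t dt` satisfies `(e^y Φ)' = e^y (γ + log y) / y`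
(`hasDerivAt_exp_mul_laplaceLogSlope`), since `(t - 1) f t = log t`. Integrating this equation from
`0` to `1` term by term produces the series, with an explicit remainder
(`abs_exp_mul_deriv_kurepa_sub_le`), once the behaviour of `Φ` at `0` is known:
`Φ(y) = ½ log² y + γ log y + γ²/2 + 5π²/12 + O(√y)` (`abs_laplaceLogSlope_sub_le`).
For this expansion, integration by parts turns `Φ(y)` into `∫₀^∞ e^{-s} F(s/y) ds`, where
`F(t) = ∫₀ᵗ f`. The function `F` is a dilogarithm with `F(1) = π²/6` and inversion formula
`F(t) + F(1/t) = ½ log² t + π²/3`; the error `F(y/s)` is `O(√(y/s))`, and the remaining integrals are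
`Γ'(1) = -γ` and `Γ''(1) = γ² + π²/6`, the latter from Euler's reflection formula.
Finally `γ` is enclosed by Euler–Maclaurin corrections of `H_n - log n`, monotone in `n`, at `n = 128`.
-/

open MeasureTheory Set Filter Topology

/-! ### The function `log t / (t - 1)` -/

/-- The function `log t / (t - 1)`, continuously extended by the value `1` at `t = 1`. -/
noncomputable def logSlope (t : ℝ) : ℝ := dslope Real.log 1 t

theorem logSlope_one : logSlope 1 = 1 := by
  simp [logSlope]

theorem logSlope_of_ne {t : ℝ} (ht : t ≠ 1) : logSlope t = Real.log t / (t - 1) := by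
  rw [logSlope, dslope_of_ne _ ht, slope_def_field, Real.log_one, sub_zero]

theorem logSlope_mul_sub_one (t : ℝ) : logSlope t * (t - 1) = Real.log t := by
  rcases eq_or_ne t 1 with rfl | ht
  · simp
  · rw [logSlope_of_ne ht, div_mul_cancel₀ _ (sub_ne_zero.mpr ht)]

theorem continuousOn_logSlope : ContinuousOn logSlope (Ioi 0) := by
  refine (continuousOn_dslope (Ioi_mem_nhds one_pos)).mpr ⟨?_, ?_⟩
  · exact Real.continuousOn_log.mono fun t (ht : 0 < t) => ht.ne'
  · exact Real.differentiableAt_log one_ne_zero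

theorem continuousAt_logSlope {t : ℝ} (ht : 0 < t) : ContinuousAt logSlope t :=
  continuousOn_logSlope.continuousAt (Ioi_mem_nhds ht)

theorem logSlope_pos {t : ℝ} (ht : 0 < t) : 0 < logSlope t := by
  rcases lt_trichotomy t 1 with h | rfl | h
  · rw [logSlope_of_ne h.ne]
    exact div_pos_of_neg_of_neg (Real.log_neg ht h) (by linarith)
  · simp [logSlope_one]
  · rw [logSlope_of_ne h.ne']
    exact div_pos (Real.log_pos h) (by linarith)

theorem logSlope_inv {t : ℝ} (ht : 0 < t) : logSlope t⁻¹ = t * logSlope t := by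
  rcases eq_or_ne t 1 with rfl | h
  · simp
  · have h' : t⁻¹ ≠ 1 := by simpa using h
    have h1 : t - 1 ≠ 0 := sub_ne_zero.mpr h
    have h2 : 1 - t ≠ 0 := sub_ne_zero.mpr h.symm
    rw [logSlope_of_ne h, logSlope_of_ne h', Real.log_inv,
      show t⁻¹ - 1 = (1 - t) / t by field_simp]
    rw [div_div_eq_mul_div, mul_div_assoc', div_eq_div_iff h2 h1]
    ring

/-- The logarithmic mean dominates the geometric mean; equivalently `u ≤ sinh u`. -/
theorem logSlope_le {t : ℝ} (ht : 0 < t) : logSlope t ≤ t ^ (-(1 / 2) : ℝ) := by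
  have key : ∀ s : ℝ, 1 < s → logSlope s ≤ (√s)⁻¹ := by
    intro s hs
    have hs0 : 0 < √s := Real.sqrt_pos.mpr (by linarith)
    have h := (Real.self_le_sinh_iff (x := Real.log √s)).mpr
      (Real.log_nonneg (Real.one_le_sqrt.mpr hs.le))
    rw [Real.sinh_log hs0, Real.log_sqrt (by linarith)] at h
    rw [logSlope_of_ne hs.ne', div_le_iff₀ (by linarith)]
    have h2 : (√s)⁻¹ * (s - 1) = √s - (√s)⁻¹ := by
      nth_rewrite 2 [← Real.mul_self_sqrt (show 0 ≤ s by linarith)]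
      field_simp
    linarith
  rw [Real.rpow_neg ht.le, ← Real.sqrt_eq_rpow]
  rcases lt_trichotomy t 1 with h | rfl | h
  · have h1 := key t⁻¹ ((one_lt_inv₀ ht).mpr h)
    rw [logSlope_inv ht, Real.sqrt_inv, inv_inv] at h1
    have hs0 : 0 < √t := Real.sqrt_pos.mpr ht
    rw [← one_div, le_div_iff₀ hs0]
    refine le_of_mul_le_mul_left (a := √t) ?_ hs0
    calc √t * (logSlope t * √t) = (√t * √t) * logSlope t := by ring
      _ ≤ √t * 1 := by rwa [Real.mul_self_sqrt ht.le, mul_one]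
  · simp [logSlope_one]
  · exact key t h

/-! ### Integrability and the derivative of the Kurepa function at `0` -/

theorem integrableOn_exp_neg_mul_rpow {y s : ℝ} (hy : 0 < y) (hs : -1 < s) :
    IntegrableOn (fun t : ℝ => Real.exp (-(y * t)) * t ^ s) (Ioi 0) := by
  refine (integrableOn_rpow_mul_exp_neg_mul_rpow hs one_pos hy).congr_fun (fun t _ => ?_)
    measurableSet_Ioi
  simp [mul_comm]

theorem integrableOn_exp_neg_rpow {s : ℝ} (hs : -1 < s) :
    IntegrableOn (fun t : ℝ => Real.exp (-t) * t ^ s) (Ioi 0) := by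
  simpa using integrableOn_exp_neg_mul_rpow one_pos hs

theorem integrableOn_exp_neg_mul_logSlope {y : ℝ} (hy : 0 < y) :
    IntegrableOn (fun t : ℝ => Real.exp (-(y * t)) * logSlope t) (Ioi 0) := by
  refine (integrableOn_exp_neg_mul_rpow hy (s := -(1 / 2)) (by norm_num)).mono' ?_ ?_
  · exact (ContinuousOn.mul (by fun_prop) continuousOn_logSlope).aestronglyMeasurable
      measurableSet_Ioi
  · refine (ae_restrict_iff' measurableSet_Ioi).mpr (ae_of_all _ fun t (ht : 0 < t) => ?_)
    rw [Real.norm_eq_abs, abs_of_nonneg (mul_nonneg (Real.exp_pos _).le (logSlope_pos ht).le)]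
    exact mul_le_mul_of_nonneg_left (logSlope_le ht) (Real.exp_pos _).le

/-- The single point `t = 1`, where `kurepaIntegrand` has a junk value, is negligible. -/
theorem ae_restrict_Ioi_of_ne_one {p : ℝ → Prop} (h : ∀ t, 0 < t → t ≠ 1 → p t) :
    ∀ᵐ t ∂(volume.restrict (Ioi (0 : ℝ))), p t := by
  rw [ae_restrict_iff' measurableSet_Ioi]
  filter_upwards [Measure.ae_ne volume (1 : ℝ)] with t h1 ht using h t ht h1

theorem measurable_kurepaIntegrand (x : ℝ) : Measurable (kurepaIntegrand x) := by
  unfold kurepaIntegrand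
  fun_prop

/-- With `v = x log t` this is `|e ^ v - 1| ≤ |v| (1 + e ^ v)`; the factor `log t` compensates the
zero of `t - 1` in the Kurepa integrand. -/
theorem abs_rpow_sub_one_le {x t : ℝ} (ht : 0 < t) :
    |t ^ x - 1| ≤ |x * Real.log t| * (1 + t ^ x) := by
  rw [Real.rpow_def_of_pos ht, mul_comm (Real.log t) x]
  set v := x * Real.log t
  have h1 := Real.add_one_le_exp v
  have h2 := Real.add_one_le_exp (-v)
  have h3 : Real.exp v * Real.exp (-v) = 1 := by rw [← Real.exp_add]; simp
  have h4 := Real.exp_pos v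
  have h5 : Real.exp v - 1 ≤ v * Real.exp v := by nlinarith
  rcases abs_cases v with ⟨h, h'⟩ | ⟨h, h'⟩ <;> rw [h, abs_le] <;> constructor <;> nlinarith

theorem integrableOn_kurepaIntegrand {x : ℝ} (hx : -1 < x) :
    IntegrableOn (kurepaIntegrand x) (Ioi 0) := by
  have hd : IntegrableOn (fun t : ℝ => (2 + 2 * |x|) *
      (Real.exp (-t) * t ^ (0 : ℝ) + Real.exp (-t) * t ^ x)) (Ioi 0) :=
    ((integrableOn_exp_neg_rpow (by norm_num)).add (integrableOn_exp_neg_rpow hx)).const_mul _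
  refine hd.mono' (measurable_kurepaIntegrand x).aestronglyMeasurable ?_
  refine ae_restrict_Ioi_of_ne_one fun t ht h1 => ?_
  have hp : 0 < t ^ x := Real.rpow_pos_of_pos ht x
  rw [kurepaIntegrand, norm_mul, Real.norm_eq_abs, Real.abs_exp, Real.rpow_zero, ← mul_add,
    mul_left_comm]
  refine mul_le_mul_of_nonneg_left ?_ (Real.exp_pos _).le
  rw [Real.norm_eq_abs, abs_div, div_le_iff₀ (abs_pos.mpr (sub_ne_zero.mpr h1))]
  -- away from `t = 1` the denominator is bounded below; near `t = 1` the slope of `log` is bounded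
  rcases le_or_gt (1 / 2) |t - 1| with h | h
  · have : |t ^ x - 1| ≤ 1 + t ^ x := by rw [abs_le]; constructor <;> linarith
    have h2 : 1 ≤ (2 + 2 * |x|) * |t - 1| := by nlinarith [abs_nonneg x]
    nlinarith
  · have ht2 : 1 / 2 < t := by linarith [(abs_lt.mp h).1]
    have hs : logSlope t ≤ 2 := by
      refine (logSlope_le ht).trans ?_
      rw [Real.rpow_neg ht.le, ← Real.sqrt_eq_rpow, inv_le_comm₀ (Real.sqrt_pos.mpr ht) two_pos]
      exact Real.le_sqrt_of_sq_le (by norm_num; linarith)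
    refine (abs_rpow_sub_one_le ht).trans ?_
    rw [abs_mul, ← logSlope_mul_sub_one t, abs_mul, abs_of_pos (logSlope_pos ht)]
    have e : |x| * (logSlope t * |t - 1|) * (1 + t ^ x)
      = (|x| * logSlope t) * (|t - 1| * (1 + t ^ x)) := by ring
    have e' : (2 + 2 * |x|) * (1 + t ^ x) * |t - 1|
      = (2 + 2 * |x|) * (|t - 1| * (1 + t ^ x)) := by ring
    rw [e, e']
    refine mul_le_mul_of_nonneg_right ?_ (by positivity)
    nlinarith [abs_nonneg x]

/-- Differentiation under the integral sign: `K'(0) = ∫₀^∞ e^{-t} log t / (t - 1) dt`. -/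
theorem hasDerivAt_kurepa_zero :
    HasDerivAt kurepa (∫ t in Ioi (0 : ℝ), Real.exp (-t) * logSlope t) 0 := by
  have key := hasDerivAt_integral_of_dominated_loc_of_deriv_le (𝕜 := ℝ)
    (μ := volume.restrict (Ioi (0 : ℝ))) (F := kurepaIntegrand)
    (F' := fun x t => Real.exp (-t) * (t ^ x * logSlope t)) (x₀ := 0)
    (s := Metric.ball 0 (1 / 4))
    (bound := fun t => Real.exp (-t) * t ^ (-(3 / 4) : ℝ) + Real.exp (-t) * t ^ (-(1 / 4) : ℝ))
    (Metric.ball_mem_nhds _ (by norm_num))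
    (Eventually.of_forall fun x => (measurable_kurepaIntegrand x).aestronglyMeasurable)
    (integrableOn_kurepaIntegrand (by norm_num)) ?_ ?_ ?_ ?_
  · have h := key.2
    simp only [Real.rpow_zero, one_mul] at h
    exact h
  · simp only [Real.rpow_zero, one_mul]
    simpa using (integrableOn_exp_neg_mul_logSlope one_pos).aestronglyMeasurable
  · refine (ae_restrict_iff' measurableSet_Ioi).mpr (ae_of_all _ fun t (ht : 0 < t) x hx => ?_)
    rw [Metric.mem_ball, dist_zero_right, Real.norm_eq_abs, abs_lt] at hx
    have hp : 0 < t ^ x := Real.rpow_pos_of_pos ht x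
    rw [Real.norm_eq_abs, abs_of_nonneg
      (mul_nonneg (Real.exp_pos _).le (mul_nonneg hp.le (logSlope_pos ht).le)), ← mul_add]
    refine mul_le_mul_of_nonneg_left ?_ (Real.exp_pos _).le
    have h0 : t ^ x * logSlope t ≤ t ^ (x - 1 / 2) := by
      rw [sub_eq_add_neg, Real.rpow_add ht]
      exact mul_le_mul_of_nonneg_left (logSlope_le ht) hp.le
    refine h0.trans ?_
    rcases le_total t 1 with h | h
    · have := Real.rpow_le_rpow_of_exponent_ge ht h (show -(3 / 4) ≤ x - 1 / 2 by linarith)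
      linarith [Real.rpow_pos_of_pos ht (-(1 / 4))]
    · have := Real.rpow_le_rpow_of_exponent_le h (show x - 1 / 2 ≤ -(1 / 4) by linarith)
      linarith [Real.rpow_pos_of_pos ht (-(3 / 4))]
  · exact (integrableOn_exp_neg_rpow (by norm_num)).add (integrableOn_exp_neg_rpow (by norm_num))
  · refine ae_restrict_Ioi_of_ne_one fun t ht h1 x _ => ?_
    have h := (((Real.hasStrictDerivAt_const_rpow ht x).hasDerivAt.sub_const 1).div_const
      (t - 1)).const_mul (Real.exp (-t))
    rw [logSlope_of_ne h1, ← mul_div_assoc (t ^ x)]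
    exact h

/-! ### The upper bound on `[0, 1]` -/

theorem kurepa_zero : kurepa 0 = 0 := by
  simp [kurepa, kurepaIntegrand]

/-- With `t = e ^ u`, the function `x u + x² (e ^ u - 1 - u) - (e ^ (x u) - 1)` is increasing in
`u`, by convexity of `exp`, and vanishes at `u = 0`; so it has the sign of `t - 1`. -/
theorem rpow_sub_one_div_le {x t : ℝ} (hx : x ∈ Icc (0 : ℝ) 1) (ht : 0 < t) (h1 : t ≠ 1) :
    (t ^ x - 1) / (t - 1) ≤ x * logSlope t + x ^ 2 * (1 - logSlope t) := by
  obtain ⟨hx0, hx1⟩ := hx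
  let g : ℝ → ℝ := fun u => x * u + x ^ 2 * (Real.exp u - 1 - u) - (Real.exp (x * u) - 1)
  have hg : ∀ u, HasDerivAt g (x + x ^ 2 * (Real.exp u - 1) - Real.exp (x * u) * x) u := by
    intro u
    have e1 := (hasDerivAt_id u).const_mul x
    have e2 := ((((Real.hasDerivAt_exp u).sub_const 1).sub (hasDerivAt_id u))).const_mul (x ^ 2)
    have e3 := (e1.exp).sub_const 1
    convert! (e1.add e2).sub e3 using 1
    simp
  have hmono : Monotone g := by
    refine monotone_of_hasDerivAt_nonneg hg fun u => ?_
    have hc := convexOn_exp.2 (mem_univ 0) (mem_univ u) (sub_nonneg.mpr hx1) hx0 (by ring)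
    simp only [smul_eq_mul, mul_zero, zero_add, Real.exp_zero, mul_one] at hc
    change 0 ≤ x + x ^ 2 * (Real.exp u - 1) - Real.exp (x * u) * x
    nlinarith
  have h0 : g 0 = 0 := by simp [g]
  have hgt : g (Real.log t)
      = (x * logSlope t + x ^ 2 * (1 - logSlope t)) * (t - 1) - (t ^ x - 1) := by
    simp only [g]
    rw [Real.exp_log ht, mul_comm x (Real.log t), ← Real.rpow_def_of_pos ht]
    linear_combination (x ^ 2 - x) * logSlope_mul_sub_one t
  rcases lt_or_gt_of_ne h1 with h | h
  · rw [div_le_iff_of_neg (by linarith)]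
    have := hmono (Real.log_neg ht h).le
    linarith
  · rw [div_le_iff₀ (by linarith)]
    have := hmono (Real.log_pos h).le
    linarith

/-- Integrated form of `rpow_sub_one_div_le`: the graph of `K` lies below a parabola which has the
same tangent at `0` and is concave as soon as `K'(0) ≥ 1`. -/
theorem kurepa_le {x : ℝ} (hx : x ∈ Icc (0 : ℝ) 1) :
    kurepa x ≤ deriv kurepa 0 * x - (deriv kurepa 0 - 1) * x ^ 2 := by
  have hi : IntegrableOn (fun t : ℝ => Real.exp (-t) * logSlope t) (Ioi 0) := by
    simpa using integrableOn_exp_neg_mul_logSlope one_pos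
  have he : IntegrableOn (fun t : ℝ => Real.exp (-t)) (Ioi 0) := by
    simpa using integrableOn_exp_neg_rpow (s := 0) (by norm_num)
  have hle : kurepa x ≤ ∫ t in Ioi (0 : ℝ),
      ((x - x ^ 2) * (Real.exp (-t) * logSlope t) + x ^ 2 * Real.exp (-t)) := by
    refine integral_mono_ae (integrableOn_kurepaIntegrand (by linarith [hx.1]))
      ((hi.const_mul _).add (he.const_mul _)) ?_
    refine ae_restrict_Ioi_of_ne_one fun t ht h1 => ?_
    have := mul_le_mul_of_nonneg_left (rpow_sub_one_div_le hx ht h1) (Real.exp_pos (-t)).le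
    rw [kurepaIntegrand]
    linarith
  rw [integral_add (hi.const_mul _) (he.const_mul _), integral_const_mul, integral_const_mul,
    integral_exp_neg_Ioi_zero, ← hasDerivAt_kurepa_zero.deriv] at hle
  linarith

/-! ### Logarithmic moments of the exponential distribution -/

/-- The measure `e^{-t} dt` on `(0, ∞)`: the exponential distribution of rate `1`. The moment
generating function of `log` under it is `x ↦ Γ(1 + x)`, whose derivatives are log moments. -/
noncomputable def expMeasure : Measure ℝ :=
  (volume.restrict (Ioi (0 : ℝ))).withDensity fun t => ENNReal.ofReal (Real.exp (-t))

theorem integrable_expMeasure_iff {g : ℝ → ℝ} :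
    Integrable g expMeasure ↔ IntegrableOn (fun t => Real.exp (-t) * g t) (Ioi 0) := by
  rw [expMeasure, integrable_withDensity_iff_integrable_smul' (by fun_prop) (by simp)]
  simp only [ENNReal.toReal_ofReal (Real.exp_pos _).le, smul_eq_mul]
  rfl

theorem integral_expMeasure (g : ℝ → ℝ) :
    ∫ t, g t ∂expMeasure = ∫ t in Ioi (0 : ℝ), Real.exp (-t) * g t := by
  rw [expMeasure, integral_withDensity_eq_integral_toReal_smul (by fun_prop) (by simp)]
  simp only [ENNReal.toReal_ofReal (Real.exp_pos _).le, smul_eq_mul]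

theorem Ioi_subset_interior_integrableExpSet_log :
    Ioi (-1) ⊆ interior (ProbabilityTheory.integrableExpSet Real.log expMeasure) := by
  refine interior_maximal (fun x (hx : -1 < x) => ?_) isOpen_Ioi
  refine integrable_expMeasure_iff.mpr ?_
  refine (integrableOn_exp_neg_rpow hx).congr_fun (fun t (ht : 0 < t) => ?_) measurableSet_Ioi
  simp only [Real.rpow_def_of_pos ht, mul_comm]

theorem mgf_log_expMeasure {x : ℝ} (hx : -1 < x) :
    ProbabilityTheory.mgf Real.log expMeasure x = Real.Gamma (1 + x) := by
  rw [ProbabilityTheory.mgf, integral_expMeasure, Real.Gamma_eq_integral (by linarith)]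
  refine setIntegral_congr_fun measurableSet_Ioi fun t (ht : 0 < t) => ?_
  simp only [Real.rpow_def_of_pos ht, add_sub_cancel_left, mul_comm]

theorem integrableOn_exp_neg_mul_log_pow (n : ℕ) :
    IntegrableOn (fun t : ℝ => Real.exp (-t) * Real.log t ^ n) (Ioi 0) :=
  integrable_expMeasure_iff.mp (ProbabilityTheory.integrable_pow_of_mem_interior_integrableExpSet
    (Ioi_subset_interior_integrableExpSet_log (by norm_num)) n)

theorem integral_exp_neg_mul_log :
    ∫ t in Ioi (0 : ℝ), Real.exp (-t) * Real.log t = -Real.eulerMascheroniConstant := by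
  have h1 := ProbabilityTheory.hasDerivAt_mgf
    (Ioi_subset_interior_integrableExpSet_log (show (0 : ℝ) ∈ Ioi (-1) by norm_num))
  have h2 : HasDerivAt (ProbabilityTheory.mgf Real.log expMeasure)
      (-Real.eulerMascheroniConstant) 0 := by
    have h := Real.hasDerivAt_Gamma_one
    rw [show (1 : ℝ) = 1 + 0 by ring] at h
    refine (h.comp_const_add 1 0).congr_of_eventuallyEq ?_
    filter_upwards [Ioi_mem_nhds (show (-1 : ℝ) < 0 by norm_num)] with x hx
      using mgf_log_expMeasure hx
  rw [← h1.unique h2, ← integral_expMeasure]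
  simp

/-- Euler's reflection formula in the form `Γ(1 + x) Γ(1 - x) sin (π x) = π x`. -/
theorem Gamma_one_add_mul_Gamma_one_sub_mul_sin {x : ℝ} (hx : |x| < 1) :
    Real.Gamma (1 + x) * Real.Gamma (1 - x) * Real.sin (Real.pi * x) = Real.pi * x := by
  rcases eq_or_ne x 0 with rfl | h0
  · simp
  have hs : Real.sin (Real.pi * x) ≠ 0 := by
    rw [abs_lt] at hx
    have hpi := Real.pi_pos
    intro h
    have := (Real.sin_eq_zero_iff_of_lt_of_lt (by nlinarith) (by nlinarith)).mp h
    exact h0 ((mul_eq_zero.mp this).resolve_left hpi.ne')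
  have h := Real.Gamma_mul_Gamma_one_sub x
  rw [add_comm, Real.Gamma_add_one h0, mul_assoc x, h, mul_assoc, div_mul_cancel₀ _ hs, mul_comm]

/-- `Γ''(1) = γ² + π²/6`, by differentiating the reflection formula three times at `0`. -/
theorem integral_exp_neg_mul_log_sq :
    ∫ t in Ioi (0 : ℝ), Real.exp (-t) * Real.log t ^ 2
      = Real.eulerMascheroniConstant ^ 2 + Real.pi ^ 2 / 6 := by
  -- `M n x = Γ⁽ⁿ⁾(1 + x)`
  let M : ℕ → ℝ → ℝ := fun n x => ∫ t, Real.log t ^ n * Real.exp (x * Real.log t) ∂expMeasure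
  have hM : ∀ n x, -1 < x → HasDerivAt (M n) (M (n + 1) x) x := fun n x hx =>
    ProbabilityTheory.hasDerivAt_integral_pow_mul_exp_real
      (Ioi_subset_interior_integrableExpSet_log hx) n
  have hMneg : ∀ n x, x < 1 → HasDerivAt (fun x => M n (-x)) (-M (n + 1) (-x)) x := by
    intro n x hx
    have h := (hM n (-x) (by linarith)).scomp x (hasDerivAt_neg x)
    simp only [neg_smul, one_smul] at h
    exact h
  have hM0 : ∀ x, -1 < x → M 0 x = Real.Gamma (1 + x) := fun x hx => by
    rw [← mgf_log_expMeasure hx]; simp [M, ProbabilityTheory.mgf]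
  have hM00 : M 0 0 = 1 := by rw [hM0 0 (by norm_num)]; simp
  have hM10 : M 1 0 = -Real.eulerMascheroniConstant := by
    rw [← integral_exp_neg_mul_log, ← integral_expMeasure]; simp [M]
  have hM20 : M 2 0 = ∫ t in Ioi (0 : ℝ), Real.exp (-t) * Real.log t ^ 2 := by
    rw [← integral_expMeasure]; simp [M]
  have hS : ∀ x, HasDerivAt (fun x => Real.sin (Real.pi * x))
      (Real.cos (Real.pi * x) * Real.pi) x := fun x => by
    simpa using ((hasDerivAt_id x).const_mul Real.pi).sin
  have hC : ∀ x, HasDerivAt (fun x => Real.cos (Real.pi * x))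
      (-Real.sin (Real.pi * x) * Real.pi) x := fun x => by
    simpa using ((hasDerivAt_id x).const_mul Real.pi).cos
  have hball : Ioo (-1 : ℝ) 1 ∈ 𝓝 (0 : ℝ) := Ioo_mem_nhds (by norm_num) (by norm_num)
  -- the reflection formula and its first two derivatives
  have e0 : ∀ x ∈ Ioo (-1 : ℝ) 1,
      M 0 x * M 0 (-x) * Real.sin (Real.pi * x) - Real.pi * x = 0 := by
    intro x hx
    rw [hM0 x hx.1, hM0 (-x) (by linarith [hx.2]), ← sub_eq_add_neg,
      Gamma_one_add_mul_Gamma_one_sub_mul_sin (abs_lt.mpr hx), sub_self]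
  have step : ∀ g g' : ℝ → ℝ, (∀ x ∈ Ioo (-1 : ℝ) 1, g x = 0) →
      (∀ x ∈ Ioo (-1 : ℝ) 1, HasDerivAt g (g' x) x) → ∀ x ∈ Ioo (-1 : ℝ) 1, g' x = 0 := by
    intro g g' hg hg' x hx
    refine (hg' x hx).unique ((hasDerivAt_const x (0 : ℝ)).congr_of_eventuallyEq ?_)
    filter_upwards [Ioo_mem_nhds hx.1 hx.2] with y hy using hg y hy
  have e1 := step _ (fun x => (M 1 x * M 0 (-x) - M 0 x * M 1 (-x)) * Real.sin (Real.pi * x)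
      + M 0 x * M 0 (-x) * (Real.cos (Real.pi * x) * Real.pi) - Real.pi) e0 (by
    intro x hx
    convert! (((hM 0 x hx.1).mul (hMneg 0 x hx.2)).mul (hS x)).sub
      ((hasDerivAt_id x).const_mul Real.pi) using 1
    simp only [Pi.mul_apply]
    ring)
  have e2 := step _ (fun x =>
      (M 2 x * M 0 (-x) - 2 * (M 1 x * M 1 (-x)) + M 0 x * M 2 (-x)) * Real.sin (Real.pi * x)
      + 2 * (M 1 x * M 0 (-x) - M 0 x * M 1 (-x)) * (Real.cos (Real.pi * x) * Real.pi)
      - M 0 x * M 0 (-x) * (Real.sin (Real.pi * x) * Real.pi ^ 2)) e1 (by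
    intro x hx
    convert! ((((((hM 1 x hx.1).mul (hMneg 0 x hx.2)).sub
      ((hM 0 x hx.1).mul (hMneg 1 x hx.2))).mul (hS x)).add
      (((hM 0 x hx.1).mul (hMneg 0 x hx.2)).mul ((hC x).mul_const Real.pi))).sub_const
      Real.pi) using 1
    simp only [Pi.mul_apply, Pi.sub_apply]
    ring)
  have e3 := step _ (fun x =>
      (M 3 x * M 0 (-x) - 3 * (M 2 x * M 1 (-x)) + 3 * (M 1 x * M 2 (-x)) - M 0 x * M 3 (-x))
        * Real.sin (Real.pi * x)
      + 3 * (M 2 x * M 0 (-x) - 2 * (M 1 x * M 1 (-x)) + M 0 x * M 2 (-x))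
        * (Real.cos (Real.pi * x) * Real.pi)
      - 3 * (M 1 x * M 0 (-x) - M 0 x * M 1 (-x)) * (Real.sin (Real.pi * x) * Real.pi ^ 2)
      - M 0 x * M 0 (-x) * (Real.cos (Real.pi * x) * Real.pi ^ 3)) e2 (by
    intro x hx
    convert! ((((((hM 2 x hx.1).mul (hMneg 0 x hx.2)).sub
      (((hM 1 x hx.1).mul (hMneg 1 x hx.2)).const_mul 2)).add
      ((hM 0 x hx.1).mul (hMneg 2 x hx.2))).mul (hS x)).add
      (((((hM 1 x hx.1).mul (hMneg 0 x hx.2)).sub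
      ((hM 0 x hx.1).mul (hMneg 1 x hx.2))).const_mul 2).mul ((hC x).mul_const Real.pi))).sub
      (((hM 0 x hx.1).mul (hMneg 0 x hx.2)).mul ((hS x).mul_const (Real.pi ^ 2))) using 1
    simp only [Pi.mul_apply, Pi.sub_apply, Pi.add_apply]
    ring) 0 ⟨by norm_num, by norm_num⟩
  simp only [mul_zero, Real.sin_zero, Real.cos_zero, neg_zero, hM00, hM10] at e3
  rw [← hM20]
  have hpi := Real.pi_pos
  have : Real.pi * (6 * M 2 0 - 6 * Real.eulerMascheroniConstant ^ 2 - Real.pi ^ 2) = 0 := by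
    linear_combination e3
  have := (mul_eq_zero.mp this).resolve_left hpi.ne'
  linarith

/-! ### The primitive of `log t / (t - 1)` and the dilogarithm inversion -/

/-- The primitive `∫₀ᵗ log s / (s - 1) ds`, a dilogarithm in disguise. -/
noncomputable def logSlopePrimitive (t : ℝ) : ℝ := ∫ s in (0 : ℝ)..t, logSlope s

theorem intervalIntegrable_logSlope {t : ℝ} (ht : 0 ≤ t) :
    IntervalIntegrable logSlope volume 0 t := by
  rw [intervalIntegrable_iff_integrableOn_Ioc_of_le ht]
  have hd : IntegrableOn (fun s : ℝ => s ^ (-(1 / 2) : ℝ)) (Ioc 0 t) :=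
    (intervalIntegrable_iff_integrableOn_Ioc_of_le ht).mp
      (intervalIntegral.intervalIntegrable_rpow' (by norm_num))
  refine hd.mono' ((continuousOn_logSlope.mono fun s hs => hs.1).aestronglyMeasurable
    measurableSet_Ioc) ?_
  refine (ae_restrict_iff' measurableSet_Ioc).mpr (ae_of_all _ fun s hs => ?_)
  rw [Real.norm_eq_abs, abs_of_pos (logSlope_pos hs.1)]
  exact logSlope_le hs.1

theorem hasDerivAt_logSlopePrimitive {t : ℝ} (ht : 0 < t) :
    HasDerivAt logSlopePrimitive (logSlope t) t :=
  intervalIntegral.integral_hasDerivAt_right (intervalIntegrable_logSlope ht.le)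
    (continuousOn_logSlope.stronglyMeasurableAtFilter isOpen_Ioi t ht) (continuousAt_logSlope ht)

theorem continuousOn_logSlopePrimitive : ContinuousOn logSlopePrimitive (Ioi 0) :=
  fun _ ht => (hasDerivAt_logSlopePrimitive ht).continuousAt.continuousWithinAt

theorem logSlopePrimitive_nonneg {t : ℝ} (ht : 0 ≤ t) : 0 ≤ logSlopePrimitive t := by
  rw [logSlopePrimitive, intervalIntegral.integral_of_le ht]
  exact setIntegral_nonneg measurableSet_Ioc fun s hs => (logSlope_pos hs.1).le

theorem logSlopePrimitive_le {t : ℝ} (ht : 0 ≤ t) :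
    logSlopePrimitive t ≤ 2 * t ^ (1 / 2 : ℝ) := by
  have h : logSlopePrimitive t ≤ ∫ s in (0 : ℝ)..t, s ^ (-(1 / 2) : ℝ) :=
    intervalIntegral.integral_mono_on_of_le_Ioo ht (intervalIntegrable_logSlope ht)
      (intervalIntegral.intervalIntegrable_rpow' (by norm_num)) fun s hs => logSlope_le hs.1
  rw [integral_rpow (Or.inl (by norm_num))] at h
  norm_num at h
  linarith

theorem integral_pow_mul_neg_log (n : ℕ) :
    IntegrableOn (fun s : ℝ => s ^ n * -Real.log s) (Ioo 0 1) ∧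
      ∫ s in Ioo (0 : ℝ) 1, s ^ n * -Real.log s = 1 / ((n + 1 : ℕ) : ℝ) ^ 2 := by
  have hi : IntervalIntegrable (fun s : ℝ => s ^ n * -Real.log s) volume 0 1 :=
    intervalIntegral.intervalIntegrable_log'.neg.continuousOn_mul (by fun_prop)
  refine ⟨((intervalIntegrable_iff_integrableOn_Ioo_of_le zero_le_one).mp hi), ?_⟩
  rw [← integral_Ioc_eq_integral_Ioo, ← intervalIntegral.integral_of_le zero_le_one]
  have hn : ((n + 1 : ℕ) : ℝ) ≠ 0 := by positivity
  -- the primitive is written with `s * log s`, which is continuous up to `s = 0`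
  rw [intervalIntegral.integral_eq_sub_of_hasDerivAt_of_le zero_le_one
    (f := fun s : ℝ => s ^ n * -(s * Real.log s) / ((n + 1 : ℕ) : ℝ)
      + s ^ (n + 1) / ((n + 1 : ℕ) : ℝ) ^ 2) ?_ ?_ hi]
  · simp
  · have := Real.continuous_mul_log
    fun_prop
  · intro s hs
    have hs0 : s ≠ 0 := hs.1.ne'
    have h1 : HasDerivAt (fun s : ℝ => s ^ (n + 1) * -Real.log s / ((n + 1 : ℕ) : ℝ)
        + s ^ (n + 1) / ((n + 1 : ℕ) : ℝ) ^ 2) (s ^ n * -Real.log s) s := by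
      convert! (((hasDerivAt_pow (n + 1) s).mul (Real.hasDerivAt_log hs0).neg).div_const
        ((n + 1 : ℕ) : ℝ)).add ((hasDerivAt_pow (n + 1) s).div_const (((n + 1 : ℕ) : ℝ) ^ 2)) using 1
      simp only [Nat.add_sub_cancel, Pi.neg_apply]
      field_simp
      ring
    refine h1.congr_of_eventuallyEq (Eventually.of_forall fun x => ?_)
    simp only
    ring

/-- `∫₀¹ log s / (s - 1) ds = ζ(2)`, by expanding `1 / (1 - s)` into a geometric series. -/
theorem logSlopePrimitive_one : logSlopePrimitive 1 = Real.pi ^ 2 / 6 := by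
  have hz : HasSum (fun n : ℕ => 1 / ((n + 1 : ℕ) : ℝ) ^ 2) (Real.pi ^ 2 / 6) := by
    have h := (hasSum_nat_add_iff' (f := fun n : ℕ => (1 : ℝ) / (n : ℝ) ^ 2) 1).mpr hasSum_zeta_two
    simpa using h
  have hnorm : ∀ n : ℕ, ∫ s in Ioo (0 : ℝ) 1, ‖s ^ n * -Real.log s‖
      = 1 / ((n + 1 : ℕ) : ℝ) ^ 2 := by
    intro n
    rw [← (integral_pow_mul_neg_log n).2]
    refine setIntegral_congr_fun measurableSet_Ioo fun s hs => ?_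
    exact Real.norm_of_nonneg (mul_nonneg (pow_nonneg hs.1.le n)
      (neg_nonneg.mpr (Real.log_nonpos hs.1.le hs.2.le)))
  have key := hasSum_integral_of_summable_integral_norm
    (μ := volume.restrict (Ioo (0 : ℝ) 1)) (F := fun (n : ℕ) (s : ℝ) => s ^ n * -Real.log s)
    (fun n => (integral_pow_mul_neg_log n).1) (by simp only [hnorm]; exact hz.summable)
  simp only [(integral_pow_mul_neg_log _).2] at key
  rw [hz.unique key, logSlopePrimitive, intervalIntegral.integral_of_le zero_le_one,
    integral_Ioc_eq_integral_Ioo]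
  refine setIntegral_congr_fun measurableSet_Ioo fun s hs => ?_
  have hne : 1 - s ≠ 0 := by linarith [hs.2]
  rw [tsum_mul_right, tsum_geometric_of_lt_one hs.1.le hs.2, logSlope_of_ne hs.2.ne,
    ← neg_sub 1 s, div_neg, div_eq_inv_mul, mul_neg]

/-- The inversion formula of the dilogarithm: both sides have the same derivative, and they agree at
`t = 1`. -/
theorem logSlopePrimitive_add_inv {t : ℝ} (ht : 0 < t) :
    logSlopePrimitive t + logSlopePrimitive t⁻¹ = Real.log t ^ 2 / 2 + Real.pi ^ 2 / 3 := by
  let g : ℝ → ℝ := fun t => logSlopePrimitive t + logSlopePrimitive t⁻¹ - Real.log t ^ 2 / 2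
  have hg : ∀ x ∈ Ioi (0 : ℝ), HasDerivAt g 0 x := by
    intro x (hx : 0 < x)
    have h1 := (hasDerivAt_logSlopePrimitive (inv_pos.mpr hx)).scomp x (hasDerivAt_inv hx.ne')
    have h2 := ((Real.hasDerivAt_log hx.ne').pow 2).div_const 2
    convert! ((hasDerivAt_logSlopePrimitive hx).add h1).sub h2 using 1
    rw [logSlope_inv hx, ← logSlope_mul_sub_one x, smul_eq_mul]
    field_simp
    ring
  have hconst := (convex_Ioi (0 : ℝ)).is_const_of_fderivWithin_eq_zero (𝕜 := ℝ) (f := g)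
    (fun x hx => (hg x hx).differentiableAt.differentiableWithinAt) (fun x hx => by
      have := (hg x hx).hasFDerivAt.hasFDerivWithinAt (s := Ioi 0)
      rw [this.fderivWithin (isOpen_Ioi.uniqueDiffWithinAt hx)]
      ext; simp) ht (mem_Ioi.mpr one_pos)
  simp only [g, inv_one, Real.log_one, logSlopePrimitive_one] at hconst
  linarith

/-! ### The Laplace transform near `0` -/

/-- The Laplace transform of `log t / (t - 1)`. Its value at `1` is `K'(0)`. -/
noncomputable def laplaceLogSlope (y : ℝ) : ℝ :=
  ∫ t in Ioi (0 : ℝ), Real.exp (-(y * t)) * logSlope t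

theorem laplaceLogSlope_one : laplaceLogSlope 1 = deriv kurepa 0 := by
  simp [laplaceLogSlope, hasDerivAt_kurepa_zero.deriv]

theorem integral_exp_neg_mul_comp_mul (g : ℝ → ℝ) {y : ℝ} (hy : 0 < y) :
    ∫ t in Ioi (0 : ℝ), Real.exp (-(y * t)) * g (y * t)
      = y⁻¹ * ∫ s in Ioi (0 : ℝ), Real.exp (-s) * g s := by
  have h := integral_comp_mul_left_Ioi (fun s => Real.exp (-s) * g s) 0 hy
  simpa using h

theorem laplaceLogSlope_nonneg (y : ℝ) : 0 ≤ laplaceLogSlope y :=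
  setIntegral_nonneg measurableSet_Ioi fun _ ht =>
    mul_nonneg (Real.exp_pos _).le (logSlope_pos ht).le

theorem laplaceLogSlope_le {y : ℝ} (hy : 0 < y) :
    laplaceLogSlope y ≤ √Real.pi * y ^ (-(1 / 2) : ℝ) := by
  have h : laplaceLogSlope y ≤ ∫ t in Ioi (0 : ℝ), t ^ ((1 / 2 : ℝ) - 1) * Real.exp (-(y * t)) := by
    refine setIntegral_mono_on (integrableOn_exp_neg_mul_logSlope hy) ?_ measurableSet_Ioi
      fun t ht => ?_
    · simpa only [mul_comm] using
        integrableOn_exp_neg_mul_rpow hy (s := (1 / 2 : ℝ) - 1) (by norm_num)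
    · rw [mul_comm]
      refine mul_le_mul_of_nonneg_right ((logSlope_le ht).trans_eq ?_) (Real.exp_pos _).le
      norm_num
  rwa [Real.integral_rpow_mul_exp_neg_mul_Ioi (by norm_num) hy, Real.Gamma_one_half_eq, mul_comm,
    one_div y, Real.inv_rpow hy.le, ← Real.rpow_neg hy.le] at h

/-- Integration by parts moves the Laplace transform onto the primitive. -/
theorem laplaceLogSlope_eq_integral_primitive {y : ℝ} (hy : 0 < y) :
    laplaceLogSlope y = ∫ s in Ioi (0 : ℝ), Real.exp (-s) * logSlopePrimitive (s / y) := by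
  have hbound : ∀ t : ℝ, 0 < t →
      |Real.exp (-(y * t)) * logSlopePrimitive t| ≤ 2 * (Real.exp (-(y * t)) * t ^ (1 / 2 : ℝ)) := by
    intro t ht
    rw [abs_of_nonneg (mul_nonneg (Real.exp_pos _).le (logSlopePrimitive_nonneg ht.le)),
      mul_left_comm]
    exact mul_le_mul_of_nonneg_left (logSlopePrimitive_le ht.le) (Real.exp_pos _).le
  have hint : IntegrableOn (fun t => Real.exp (-(y * t)) * logSlopePrimitive t) (Ioi 0) := by
    refine ((integrableOn_exp_neg_mul_rpow hy (s := 1 / 2) (by norm_num)).const_mul 2).mono' ?_ ?_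
    · exact (ContinuousOn.mul (by fun_prop) continuousOn_logSlopePrimitive).aestronglyMeasurable
        measurableSet_Ioi
    · exact (ae_restrict_iff' measurableSet_Ioi).mpr (ae_of_all _ hbound)
  have hexp : ∀ t ∈ Ioi (0 : ℝ), HasDerivAt (fun t => Real.exp (-(y * t)))
      (-y * Real.exp (-(y * t))) t := by
    intro t _
    have := ((hasDerivAt_id t).const_mul y).neg.exp
    simpa [mul_comm] using this
  have hparts := integral_Ioi_mul_deriv_eq_deriv_mul (a := (0 : ℝ)) (a' := (0 : ℝ)) (b' := (0 : ℝ))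
    (u := fun t => Real.exp (-(y * t))) (u' := fun t => -y * Real.exp (-(y * t)))
    (v := logSlopePrimitive) (v' := logSlope)
    hexp (fun t ht => hasDerivAt_logSlopePrimitive ht) (integrableOn_exp_neg_mul_logSlope hy) ?_ ?_ ?_
  · rw [laplaceLogSlope, hparts]
    have h := integral_exp_neg_mul_comp_mul (fun s => logSlopePrimitive (s / y)) hy
    simp only [mul_div_cancel_left₀ _ hy.ne'] at h
    simp only [neg_mul, integral_neg, mul_assoc, integral_const_mul]
    rw [h]
    field_simp
    ring
  · refine (hint.const_mul (-y)).congr (ae_of_all _ fun t => ?_)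
    simp [mul_assoc]
  · refine squeeze_zero_norm' (a := fun t => 2 * (Real.exp (-(y * t)) * t ^ (1 / 2 : ℝ))) ?_ ?_
    · filter_upwards [self_mem_nhdsWithin] with t ht using hbound t ht
    · have : Continuous fun t : ℝ => 2 * (Real.exp (-(y * t)) * t ^ (1 / 2 : ℝ)) := by
        have := Real.continuous_rpow_const (q := 1 / 2) (by norm_num)
        fun_prop
      have h := (this.tendsto 0).mono_left (nhdsWithin_le_nhds (s := Ioi 0))
      simpa using h
  · refine squeeze_zero_norm' (a := fun t => 2 * (Real.exp (-(y * t)) * t ^ (1 / 2 : ℝ))) ?_ ?_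
    · filter_upwards [eventually_gt_atTop 0] with t ht using hbound t ht
    · have h := (tendsto_rpow_mul_exp_neg_mul_atTop_nhds_zero (1 / 2) y hy).const_mul 2
      simpa [mul_comm] using h

/-- The constant term of the expansion of the Laplace transform at `y = 0`. -/
noncomputable def laplaceConst : ℝ :=
  Real.eulerMascheroniConstant ^ 2 / 2 + 5 * Real.pi ^ 2 / 12

/-- The expansion at `y = 0`: in `∫ e^{-s} F(s/y) ds` the inversion formula replaces `F(s/y)` by
`½ (log s - log y)² + π²/3 - F(y/s)`, whose last term is `O(√(y/s))`. -/
theorem abs_laplaceLogSlope_sub_le {y : ℝ} (hy : 0 < y) :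
    |laplaceLogSlope y - (Real.eulerMascheroniConstant * Real.log y + Real.log y ^ 2 / 2
      + laplaceConst)| ≤ 2 * √Real.pi * y ^ (1 / 2 : ℝ) := by
  set γ := Real.eulerMascheroniConstant with hγ
  have hinv : ∀ s ∈ Ioi (0 : ℝ), Real.exp (-s) * logSlopePrimitive (y / s)
      ≤ 2 * y ^ (1 / 2 : ℝ) * (Real.exp (-s) * s ^ ((1 / 2 : ℝ) - 1)) := by
    intro s (hs : 0 < s)
    have h := logSlopePrimitive_le (div_pos hy hs).le
    rw [Real.div_rpow hy.le hs.le, div_eq_mul_inv (y ^ (1 / 2 : ℝ)), ← Real.rpow_neg hs.le] at h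
    have h' := mul_le_mul_of_nonneg_left h (Real.exp_pos (-s)).le
    refine h'.trans_eq ?_
    norm_num
    ring
  have hnn : ∀ s ∈ Ioi (0 : ℝ), 0 ≤ Real.exp (-s) * logSlopePrimitive (y / s) :=
    fun s hs => mul_nonneg (Real.exp_pos _).le (logSlopePrimitive_nonneg (div_pos hy hs).le)
  have hdom := (integrableOn_exp_neg_rpow (s := (1 / 2 : ℝ) - 1) (by norm_num)).const_mul
    (2 * y ^ (1 / 2 : ℝ))
  have hint : IntegrableOn (fun s => Real.exp (-s) * logSlopePrimitive (y / s)) (Ioi 0) := by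
    refine hdom.mono' ?_ ?_
    · refine (ContinuousOn.mul (by fun_prop)
        (continuousOn_logSlopePrimitive.comp (f := fun s => y / s) ?_
          fun s hs => div_pos hy hs)).aestronglyMeasurable measurableSet_Ioi
      exact continuousOn_const.div continuousOn_id fun s (hs : 0 < s) => hs.ne'
    · refine (ae_restrict_iff' measurableSet_Ioi).mpr (ae_of_all _ fun s hs => ?_)
      rw [Real.norm_eq_abs, abs_of_nonneg (hnn s hs)]
      exact hinv s hs
  have hR : ∫ s in Ioi (0 : ℝ), Real.exp (-s) * logSlopePrimitive (y / s)
      ≤ 2 * √Real.pi * y ^ (1 / 2 : ℝ) := by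
    have h := setIntegral_mono_on hint hdom measurableSet_Ioi hinv
    rw [integral_const_mul, ← Real.Gamma_eq_integral (by norm_num), Real.Gamma_one_half_eq] at h
    linarith
  have hR0 := setIntegral_nonneg (μ := volume) measurableSet_Ioi hnn
  have i0 := (integrableOn_exp_neg_mul_log_pow 0).const_mul (Real.log y ^ 2 / 2 + Real.pi ^ 2 / 3)
  have i1 := (integrableOn_exp_neg_mul_log_pow 1).const_mul (-Real.log y)
  have i2 := (integrableOn_exp_neg_mul_log_pow 2).const_mul (1 / 2)
  have hmain : laplaceLogSlope y = 1 / 2 * (γ ^ 2 + Real.pi ^ 2 / 6) + -Real.log y * -γ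
      + (Real.log y ^ 2 / 2 + Real.pi ^ 2 / 3)
      - ∫ s in Ioi (0 : ℝ), Real.exp (-s) * logSlopePrimitive (y / s) := by
    have e0 : ∫ s in Ioi (0 : ℝ), Real.exp (-s) * Real.log s ^ 0 = 1 := by
      simpa only [pow_zero, mul_one] using integral_exp_neg_Ioi_zero
    have e1 : ∫ s in Ioi (0 : ℝ), Real.exp (-s) * Real.log s ^ 1 = -γ := by
      simpa using integral_exp_neg_mul_log
    have hsum := integral_sub ((i2.add i1).add i0) hint
    rw [integral_add' (i2.add i1) i0, integral_add' i2 i1, integral_const_mul, integral_const_mul,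
      integral_const_mul, e0, e1, integral_exp_neg_mul_log_sq, mul_one] at hsum
    rw [← hsum, laplaceLogSlope_eq_integral_primitive hy]
    refine setIntegral_congr_fun measurableSet_Ioi fun s (hs : 0 < s) => ?_
    have h := logSlopePrimitive_add_inv (div_pos hs hy)
    rw [inv_div, Real.log_div hs.ne' hy.ne'] at h
    simp only [Pi.add_apply]
    linear_combination Real.exp (-s) * h
  rw [hmain, laplaceConst, abs_le]
  constructor <;> linarith

/-! ### The differential equation of the Laplace transform -/

theorem mul_rpow_neg_half {t : ℝ} (ht : 0 < t) :
    t * t ^ (-(1 / 2) : ℝ) = t ^ (1 / 2 : ℝ) := by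
  rw [mul_comm, ← Real.rpow_add_one ht.ne']
  norm_num

theorem hasDerivAt_laplaceLogSlope {y : ℝ} (hy : 0 < y) :
    IntegrableOn (fun t => -t * (Real.exp (-(y * t)) * logSlope t)) (Ioi 0) ∧
    HasDerivAt laplaceLogSlope
      (∫ t in Ioi (0 : ℝ), -t * (Real.exp (-(y * t)) * logSlope t)) y := by
  have key := hasDerivAt_integral_of_dominated_loc_of_deriv_le (𝕜 := ℝ)
    (μ := volume.restrict (Ioi (0 : ℝ))) (F := fun y t => Real.exp (-(y * t)) * logSlope t)
    (F' := fun y t => -t * (Real.exp (-(y * t)) * logSlope t)) (x₀ := y)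
    (s := Ioi (y / 2))
    (bound := fun t => Real.exp (-(y / 2 * t)) * t ^ (1 / 2 : ℝ))
    (Ioi_mem_nhds (by linarith)) ?_ (integrableOn_exp_neg_mul_logSlope hy) ?_ ?_ ?_ ?_
  · exact key
  · filter_upwards [Ioi_mem_nhds hy] with z hz
      using (integrableOn_exp_neg_mul_logSlope hz).aestronglyMeasurable
  · exact AEStronglyMeasurable.mul (by fun_prop)
      (integrableOn_exp_neg_mul_logSlope hy).aestronglyMeasurable
  · refine (ae_restrict_iff' measurableSet_Ioi).mpr
      (ae_of_all _ fun t (ht : 0 < t) z (hz : y / 2 < z) => ?_)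
    have h1 : t * logSlope t ≤ t ^ (1 / 2 : ℝ) := by
      have h := mul_le_mul_of_nonneg_left (logSlope_le ht) ht.le
      rwa [mul_rpow_neg_half ht] at h
    have h2 : Real.exp (-(z * t)) ≤ Real.exp (-(y / 2 * t)) :=
      Real.exp_le_exp.mpr (neg_le_neg (mul_le_mul_of_nonneg_right hz.le ht.le))
    rw [norm_mul, norm_neg, Real.norm_of_nonneg ht.le, Real.norm_of_nonneg
      (mul_nonneg (Real.exp_pos _).le (logSlope_pos ht).le), mul_left_comm]
    exact mul_le_mul h2 h1 (mul_nonneg ht.le (logSlope_pos ht).le) (Real.exp_pos _).le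
  · exact integrableOn_exp_neg_mul_rpow (by linarith) (by norm_num)
  · refine ae_of_all _ fun t z _ => ?_
    have h := (((hasDerivAt_id z).mul_const t).neg.exp).mul_const (logSlope t)
    convert! h using 1
    simp only [id, Pi.neg_apply]
    ring

/-- Multiplying `log t / (t - 1)` by `t - 1` leaves the elementary transform of `log`, which gives
the differential equation `(e^y Φ)' = e^y (γ + log y) / y` for the Laplace transform `Φ`. -/
theorem hasDerivAt_exp_mul_laplaceLogSlope {y : ℝ} (hy : 0 < y) :
    HasDerivAt (fun y => Real.exp y * laplaceLogSlope y)
      (Real.exp y * ((Real.eulerMascheroniConstant + Real.log y) / y)) y := by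
  have hlog : ∫ t in Ioi (0 : ℝ), Real.exp (-(y * t)) * Real.log t
      = -((Real.eulerMascheroniConstant + Real.log y) / y) := by
    have h := integral_exp_neg_mul_comp_mul (fun s => Real.log s - Real.log y) hy
    have i1 : IntegrableOn (fun t => Real.exp (-t) * Real.log t) (Ioi 0) := by
      simpa using integrableOn_exp_neg_mul_log_pow 1
    have i0 : IntegrableOn (fun t => Real.exp (-t) * Real.log y) (Ioi 0) := by
      have h0 := (integrableOn_exp_neg_mul_log_pow 0).mul_const (Real.log y)
      simp only [pow_zero, mul_one] at h0
      exact h0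
    simp only [mul_sub (Real.exp _)] at h
    rw [integral_sub i1 i0, integral_exp_neg_mul_log, integral_mul_const,
      integral_exp_neg_Ioi_zero] at h
    have h' : ∫ t in Ioi (0 : ℝ), Real.exp (-(y * t)) * Real.log t
        = ∫ t in Ioi (0 : ℝ), (Real.exp (-(y * t)) * Real.log (y * t)
          - Real.exp (-(y * t)) * Real.log y) := by
      refine setIntegral_congr_fun measurableSet_Ioi fun t (ht : 0 < t) => ?_
      rw [Real.log_mul hy.ne' ht.ne']
      ring
    rw [h', h]
    field_simp
    ring
  obtain ⟨hI, hderiv⟩ := hasDerivAt_laplaceLogSlope hy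
  have hsum : laplaceLogSlope y + ∫ t in Ioi (0 : ℝ), -t * (Real.exp (-(y * t)) * logSlope t)
      = (Real.eulerMascheroniConstant + Real.log y) / y := by
    rw [laplaceLogSlope, ← integral_add (integrableOn_exp_neg_mul_logSlope hy) hI,
      ← neg_inj, ← hlog, ← integral_neg]
    refine setIntegral_congr_fun measurableSet_Ioi fun t _ => ?_
    rw [← logSlope_mul_sub_one]
    ring
  rw [← hsum]
  convert! (Real.hasDerivAt_exp y).mul hderiv using 1
  ring

/-- `e^y Φ(y)` without its singular part at `y = 0`. -/
noncomputable def regularizedLaplace (y : ℝ) : ℝ :=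
  Real.exp y * laplaceLogSlope y - Real.eulerMascheroniConstant * Real.log y - Real.log y ^ 2 / 2

theorem hasDerivAt_regularizedLaplace {y : ℝ} (hy : 0 < y) :
    HasDerivAt regularizedLaplace
      ((Real.exp y - 1) * ((Real.eulerMascheroniConstant + Real.log y) / y)) y := by
  have hl := Real.hasDerivAt_log hy.ne'
  convert! ((hasDerivAt_exp_mul_laplaceLogSlope hy).sub
    (hl.const_mul Real.eulerMascheroniConstant)).sub ((hl.pow 2).div_const 2) using 1
  field_simp
  ring

theorem tendsto_regularizedLaplace :
    Tendsto regularizedLaplace (𝓝[>] 0) (𝓝 laplaceConst) := by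
  have hhalf : Tendsto (fun y : ℝ => y ^ (1 / 2 : ℝ)) (𝓝[>] 0) (𝓝 0) := by
    have h := ((Real.continuous_rpow_const (q := 1 / 2) (by norm_num)).tendsto 0).mono_left
      (nhdsWithin_le_nhds (s := Ioi (0 : ℝ)))
    simpa using h
  have hlim : Tendsto (fun y : ℝ => 4 * √Real.pi * y ^ (1 / 2 : ℝ)) (𝓝[>] 0) (𝓝 0) := by
    simpa using hhalf.const_mul (4 * √Real.pi)
  rw [tendsto_iff_norm_sub_tendsto_zero]
  refine squeeze_zero' (Eventually.of_forall fun _ => norm_nonneg _) ?_ hlim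
  filter_upwards [Ioo_mem_nhdsGT (show (0 : ℝ) < 1 by norm_num)] with y hy
  have hy0 := hy.1
  have h1 := abs_laplaceLogSlope_sub_le hy0
  have h2 : |(Real.exp y - 1) * laplaceLogSlope y| ≤ 2 * √Real.pi * y ^ (1 / 2 : ℝ) := by
    have he : Real.exp y - 1 ≤ 2 * y := by
      have := Real.abs_exp_sub_one_le (x := y) (by rw [abs_of_pos hy0]; exact hy.2.le)
      rw [abs_of_pos hy0] at this
      exact (le_abs_self _).trans this
    have he0 : 0 ≤ Real.exp y - 1 := by linarith [Real.add_one_le_exp y]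
    rw [abs_of_nonneg (mul_nonneg he0 (laplaceLogSlope_nonneg y))]
    calc (Real.exp y - 1) * laplaceLogSlope y
        ≤ 2 * y * (√Real.pi * y ^ (-(1 / 2) : ℝ)) :=
          mul_le_mul he (laplaceLogSlope_le hy0) (laplaceLogSlope_nonneg y) (by linarith)
      _ = 2 * √Real.pi * y ^ (1 / 2 : ℝ) := by rw [← mul_rpow_neg_half hy0]; ring
  have e : regularizedLaplace y - laplaceConst = (Real.exp y - 1) * laplaceLogSlope y +
      (laplaceLogSlope y - (Real.eulerMascheroniConstant * Real.log y + Real.log y ^ 2 / 2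
      + laplaceConst)) := by
    rw [regularizedLaplace]; ring
  rw [e, Real.norm_eq_abs]
  linarith [abs_add_le ((Real.exp y - 1) * laplaceLogSlope y) (laplaceLogSlope y
    - (Real.eulerMascheroniConstant * Real.log y + Real.log y ^ 2 / 2 + laplaceConst))]

/-- Partial sums of the series `∑ ((γ + log y) / (k k!) - 1 / (k² k!)) y ^ k`, `k ≥ 1`, which
arises by integrating `(e^y - 1) (γ + log y) / y` term by term. -/
noncomputable def laplacePartialSum (N : ℕ) (y : ℝ) : ℝ :=
  ∑ n ∈ Finset.range N, ((Real.eulerMascheroniConstant + Real.log y) /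
    ((n + 1 : ℕ) * (n + 1).factorial) - 1 / ((n + 1 : ℕ) ^ 2 * (n + 1).factorial)) * y ^ (n + 1)

theorem hasDerivAt_laplacePartialSum (N : ℕ) {y : ℝ} (hy : 0 < y) :
    HasDerivAt (laplacePartialSum N)
      ((Real.eulerMascheroniConstant + Real.log y) / y *
        (∑ n ∈ Finset.range (N + 1), y ^ n / n.factorial - 1)) y := by
  rw [Finset.sum_range_succ', pow_zero, Nat.factorial_zero, Nat.cast_one, div_one,
    add_sub_cancel_right, Finset.mul_sum]
  refine HasDerivAt.fun_sum fun n _ => ?_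
  convert! ((((Real.hasDerivAt_log hy.ne').const_add Real.eulerMascheroniConstant).div_const
    (((n + 1 : ℕ) : ℝ) * (n + 1).factorial)).sub_const
    (1 / (((n + 1 : ℕ) : ℝ) ^ 2 * (n + 1).factorial))).mul (hasDerivAt_pow (n + 1) y) using 1
  have h1 : ((n + 1 : ℕ) : ℝ) ≠ 0 := by positivity
  have h2 : (((n + 1).factorial : ℕ) : ℝ) ≠ 0 := by positivity
  simp only [Nat.add_sub_cancel]
  field_simp
  ring

theorem tendsto_laplacePartialSum (N : ℕ) :
    Tendsto (laplacePartialSum N) (𝓝[>] 0) (𝓝 0) := by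
  have hterm : ∀ n ∈ Finset.range N, Tendsto (fun y : ℝ =>
      ((Real.eulerMascheroniConstant + Real.log y) / ((n + 1 : ℕ) * (n + 1).factorial)
        - 1 / ((n + 1 : ℕ) ^ 2 * (n + 1).factorial)) * y ^ (n + 1)) (𝓝[>] 0) (𝓝 0) := by
    intro n _
    have hc : Continuous fun y : ℝ =>
        (Real.eulerMascheroniConstant * y + y * Real.log y) * y ^ n /
          ((n + 1 : ℕ) * (n + 1).factorial) - y ^ (n + 1) / ((n + 1 : ℕ) ^ 2 * (n + 1).factorial) := by
      have := Real.continuous_mul_log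
      fun_prop
    have h := (hc.tendsto 0).mono_left (nhdsWithin_le_nhds (s := Ioi (0 : ℝ)))
    simp only [mul_zero, zero_mul, add_zero, zero_div, ne_eq, Nat.succ_ne_zero, not_false_eq_true,
      zero_pow, sub_zero] at h
    refine h.congr fun y => ?_
    ring
  have h := tendsto_finsetSum _ hterm
  rw [Finset.sum_const_zero] at h
  exact h

/-- The closed form of `e K'(0)`, with the series truncated after `N` terms. The error term, as a
function of `y`, has as derivative `(γ + log y) / y` times the Taylor remainder of `exp`, which is bounded
on `(0, 1]` because `|γ + log y| ≤ 1 / y`. -/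
theorem abs_exp_mul_deriv_kurepa_sub_le {N : ℕ} (hN : 1 ≤ N) :
    |Real.exp 1 * deriv kurepa 0 - laplaceConst - laplacePartialSum N 1|
      ≤ (N + 2 : ℕ) / ((N + 1).factorial * (N + 1 : ℕ)) := by
  set B : ℝ := (N + 2 : ℕ) / ((N + 1).factorial * (N + 1 : ℕ)) with hB
  have hB0 : 0 ≤ B := by positivity
  let E : ℝ → ℝ := fun y => regularizedLaplace y - laplacePartialSum N y
  have hE1 : E 1 = Real.exp 1 * deriv kurepa 0 - laplacePartialSum N 1 := by
    simp [E, regularizedLaplace, laplaceLogSlope_one]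
  have hElim : Tendsto E (𝓝[>] 0) (𝓝 laplaceConst) := by
    simpa using tendsto_regularizedLaplace.sub (tendsto_laplacePartialSum N)
  have hder : ∀ y ∈ Ioc (0 : ℝ) 1, HasDerivWithinAt E
      ((Real.eulerMascheroniConstant + Real.log y) / y *
        (Real.exp y - ∑ n ∈ Finset.range (N + 1), y ^ n / n.factorial)) (Ioc 0 1) y := by
    intro y hy
    refine HasDerivAt.hasDerivWithinAt ?_
    convert! (hasDerivAt_regularizedLaplace hy.1).sub (hasDerivAt_laplacePartialSum N hy.1) using 1
    ring
  have hbound : ∀ y ∈ Ioc (0 : ℝ) 1, ‖(Real.eulerMascheroniConstant + Real.log y) / y *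
        (Real.exp y - ∑ n ∈ Finset.range (N + 1), y ^ n / n.factorial)‖ ≤ B := by
    rintro y ⟨hy0, hy1⟩
    have hr := Real.exp_bound' hy0.le hy1 (Nat.succ_pos N)
    have hr0 := Real.sum_le_exp_of_nonneg hy0.le (N + 1)
    have hlog1 := Real.one_sub_inv_le_log_of_pos hy0
    have hlog2 := Real.log_nonpos hy0.le hy1
    have hinv : 1 ≤ y⁻¹ := (one_le_inv₀ hy0).mpr hy1
    have hg1 := Real.one_half_lt_eulerMascheroniConstant
    have hg2 := Real.eulerMascheroniConstant_lt_two_thirds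
    have hl : |Real.eulerMascheroniConstant + Real.log y| ≤ y⁻¹ := by
      rw [abs_le]; constructor <;> linarith
    have hr' : Real.exp y - ∑ n ∈ Finset.range (N + 1), y ^ n / n.factorial ≤ y ^ (N + 1) * B := by
      have e : y ^ (N + 1) * B = y ^ (N + 1) * (((N + 1 : ℕ) : ℝ) + 1)
          / ((N + 1).factorial * (N + 1 : ℕ)) := by
        rw [hB]; push_cast; ring
      rw [e]
      simp only [Nat.succ_eq_add_one] at hr
      linarith
    rw [norm_mul, norm_div, Real.norm_eq_abs, Real.norm_of_nonneg hy0.le,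
      Real.norm_of_nonneg (sub_nonneg.mpr hr0)]
    calc |Real.eulerMascheroniConstant + Real.log y| / y *
          (Real.exp y - ∑ n ∈ Finset.range (N + 1), y ^ n / n.factorial)
        ≤ y⁻¹ / y * (y ^ (N + 1) * B) :=
          mul_le_mul (div_le_div_of_nonneg_right hl hy0.le) hr' (sub_nonneg.mpr hr0) (by positivity)
      _ = y ^ (N - 1) * B := by
          obtain ⟨k, rfl⟩ := Nat.exists_eq_add_of_le hN
          rw [Nat.add_sub_cancel_left]
          field_simp
          ring
      _ ≤ B := mul_le_of_le_one_left hB0 (pow_le_one₀ hy0.le hy1)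
  have hE : ∀ᶠ y in 𝓝[>] (0 : ℝ), ‖E 1 - E y‖ ≤ B := by
    filter_upwards [Ioo_mem_nhdsGT (show (0 : ℝ) < 1 by norm_num)] with y hy
    have h := (convex_Ioc (0 : ℝ) 1).norm_image_sub_le_of_norm_hasDerivWithin_le hder hbound
      (Ioo_subset_Ioc_self hy) (right_mem_Ioc.mpr one_pos)
    refine h.trans (mul_le_of_le_one_right hB0 ?_)
    rw [Real.norm_eq_abs, abs_le]
    constructor <;> linarith [hy.1, hy.2]
  have h := le_of_tendsto ((tendsto_const_nhds.sub hElim).norm) hE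
  rwa [hE1, Real.norm_eq_abs, sub_right_comm] at h

/-! ### Numerical enclosures -/

/-- Bounds for `log (1 + 1 / x)` from the power series of `artanh` at `1 / (2 x + 1)`. -/
theorem log_add_one_sub_log_bounds {x : ℝ} (hx : 0 < x) (n : ℕ) :
    2 * ∑ i ∈ Finset.range n, (1 / (2 * x + 1)) ^ (2 * i + 1) / (2 * i + 1)
        ≤ Real.log (x + 1) - Real.log x ∧
      Real.log (x + 1) - Real.log x
        ≤ 2 * (∑ i ∈ Finset.range n, (1 / (2 * x + 1)) ^ (2 * i + 1) / (2 * i + 1)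
          + (1 / (2 * x + 1)) ^ (2 * n + 1) / (1 - (1 / (2 * x + 1)) ^ 2)) := by
  have h0 : 0 ≤ 1 / (2 * x + 1) := by positivity
  have h1 : 1 / (2 * x + 1) < 1 := by
    rw [div_lt_one (by positivity)]
    linarith
  have e : (1 + 1 / (2 * x + 1)) / (1 - 1 / (2 * x + 1)) = (x + 1) / x := by
    have h2 : 1 - 1 / (2 * x + 1) = 2 * x / (2 * x + 1) := by field_simp; ring
    rw [h2]
    field_simp
    ring
  have hlo := Real.sum_range_le_log_div h0 h1 n
  have hup := Real.log_div_le_sum_range_add h0 h1 n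
  rw [e, Real.log_div (by positivity) hx.ne'] at hlo hup
  constructor <;> linarith

/-- The Euler–Maclaurin approximation `H_m - log m - 1/(2m) + 1/(12m²)` of `γ` at `m = n + 1`,
which decreases to `γ`. -/
noncomputable def gammaUpper (n : ℕ) : ℝ :=
  harmonic (n + 1) - Real.log (n + 1 : ℕ) - 1 / (2 * (n + 1 : ℕ)) + 1 / (12 * (n + 1 : ℕ) ^ 2)

/-- The Euler–Maclaurin approximation `H_m - log m - 1/(2m) + 1/(12m²) - 1/(120m⁴)` of `γ` at
`m = n + 1`, which increases to `γ`. -/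
noncomputable def gammaLower (n : ℕ) : ℝ :=
  gammaUpper n - 1 / (120 * (n + 1 : ℕ) ^ 4)

theorem gammaUpper_succ_sub (n : ℕ) {x : ℝ} (hx : x = (n + 1 : ℕ)) :
    gammaUpper (n + 1) - gammaUpper n = 1 / (x + 1) - (Real.log (x + 1) - Real.log x)
      - 1 / (2 * (x + 1)) + 1 / (2 * x) + 1 / (12 * (x + 1) ^ 2) - 1 / (12 * x ^ 2) := by
  have hx' : ((n + 1 + 1 : ℕ) : ℝ) = x + 1 := by rw [hx]; push_cast; ring
  rw [gammaUpper, gammaUpper, harmonic_succ (n + 1), Rat.cast_add, Rat.cast_inv, Rat.cast_natCast,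
    hx', ← hx]
  ring

/-- The first two terms of the series bounding `log (1 + 1 / x)` from below suffice. -/
theorem antitone_gammaUpper : Antitone gammaUpper := by
  refine antitone_nat_of_succ_le fun n => ?_
  obtain ⟨x, hx⟩ : ∃ x : ℝ, x = (n + 1 : ℕ) := ⟨_, rfl⟩
  have hx1 : 0 < x := by rw [hx]; positivity
  have h := (log_add_one_sub_log_bounds hx1 2).1
  have hd := gammaUpper_succ_sub n hx
  simp only [Finset.sum_range_succ, Finset.sum_range_zero] at h
  norm_num at h
  have key : 1 / (x + 1) - 2 * ((2 * x + 1)⁻¹ + ((2 * x + 1) ^ 3)⁻¹ / 3)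
      - 1 / (2 * (x + 1)) + 1 / (2 * x) + 1 / (12 * (x + 1) ^ 2) - 1 / (12 * x ^ 2) ≤ 0 := by
    have e : 1 / (x + 1) - 2 * ((2 * x + 1)⁻¹ + ((2 * x + 1) ^ 3)⁻¹ / 3)
      - 1 / (2 * (x + 1)) + 1 / (2 * x) + 1 / (12 * (x + 1) ^ 2) - 1 / (12 * x ^ 2)
      = -(2 * x ^ 2 + 2 * x + 1) / (12 * x ^ 2 * (x + 1) ^ 2 * (2 * x + 1) ^ 3) := by
      field_simp
      ring
    rw [e]
    exact div_nonpos_of_nonpos_of_nonneg (by nlinarith) (by positivity)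
  linarith

/-- Three terms of the series bounding `log (1 + 1 / x)` from above, with the tail estimate,
suffice: the numerator of the difference then has positive coefficients. -/
theorem monotone_gammaLower : Monotone gammaLower := by
  refine monotone_nat_of_le_succ fun n => ?_
  obtain ⟨x, hx⟩ : ∃ x : ℝ, x = (n + 1 : ℕ) := ⟨_, rfl⟩
  have hx' : ((n + 1 + 1 : ℕ) : ℝ) = x + 1 := by rw [hx]; push_cast; ring
  have hx1 : 0 < x := by rw [hx]; positivity
  have h := (log_add_one_sub_log_bounds hx1 3).2
  have hd := gammaUpper_succ_sub n hx
  rw [gammaLower, gammaLower, hx', ← hx]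
  simp only [Finset.sum_range_succ, Finset.sum_range_zero] at h
  norm_num at h
  have h2 : 1 - ((2 * x + 1) ^ 2)⁻¹ = 4 * x * (x + 1) / (2 * x + 1) ^ 2 := by field_simp; ring
  rw [h2] at h
  have key : 0 ≤ 1 / (x + 1) - 2 * ((2 * x + 1)⁻¹ + ((2 * x + 1) ^ 3)⁻¹ / 3
      + ((2 * x + 1) ^ 5)⁻¹ / 5
      + ((2 * x + 1) ^ 7)⁻¹ / (4 * x * (x + 1) / (2 * x + 1) ^ 2))
      - 1 / (2 * (x + 1)) + 1 / (2 * x) + 1 / (12 * (x + 1) ^ 2) - 1 / (12 * x ^ 2)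
      - 1 / (120 * (x + 1) ^ 4) + 1 / (120 * x ^ 4) := by
    have e : 1 / (x + 1) - 2 * ((2 * x + 1)⁻¹ + ((2 * x + 1) ^ 3)⁻¹ / 3
      + ((2 * x + 1) ^ 5)⁻¹ / 5
      + ((2 * x + 1) ^ 7)⁻¹ / (4 * x * (x + 1) / (2 * x + 1) ^ 2))
      - 1 / (2 * (x + 1)) + 1 / (2 * x) + 1 / (12 * (x + 1) ^ 2) - 1 / (12 * x ^ 2)
      - 1 / (120 * (x + 1) ^ 4) + 1 / (120 * x ^ 4)
      = (1 + 14 * x + 76 * x ^ 2 + 164 * x ^ 3 + 182 * x ^ 4 + 120 * x ^ 5 + 40 * x ^ 6)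
        / (120 * x ^ 4 * (x + 1) ^ 4 * (2 * x + 1) ^ 5) := by
      field_simp
      ring
    rw [e]
    positivity
  linarith

theorem tendsto_one_div_mul_succ_pow (c : ℝ) {k : ℕ} (hk : k ≠ 0) :
    Tendsto (fun n : ℕ => 1 / (c * ((n + 1 : ℕ) : ℝ) ^ k)) atTop (𝓝 0) := by
  have h1 : Tendsto (fun n : ℕ => ((n + 1 : ℕ) : ℝ)) atTop atTop :=
    tendsto_natCast_atTop_atTop.comp (tendsto_add_atTop_nat 1)
  have h2 := ((tendsto_pow_atTop hk).comp h1).inv_tendsto_atTop.const_mul c⁻¹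
  rw [mul_zero] at h2
  refine h2.congr fun n => ?_
  simp [mul_comm]

theorem tendsto_gammaUpper : Tendsto gammaUpper atTop (𝓝 Real.eulerMascheroniConstant) := by
  have h := (((tendsto_add_atTop_iff_nat 1).mpr Real.tendsto_harmonic_sub_log).sub
    (tendsto_one_div_mul_succ_pow 2 one_ne_zero)).add (tendsto_one_div_mul_succ_pow 12 two_ne_zero)
  simp only [pow_one, sub_zero, add_zero] at h
  exact h

theorem tendsto_gammaLower : Tendsto gammaLower atTop (𝓝 Real.eulerMascheroniConstant) := by
  have h := tendsto_gammaUpper.sub (tendsto_one_div_mul_succ_pow 120 four_ne_zero)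
  rw [sub_zero] at h
  exact h

theorem log_two_bounds :
    0.6931471805599 < Real.log 2 ∧ Real.log 2 < 0.6931471805600 := by
  have h := log_add_one_sub_log_bounds one_pos 14
  simp only [Finset.sum_range_succ, Finset.sum_range_zero, Real.log_one, sub_zero] at h
  norm_num at h
  constructor <;> linarith [h.1, h.2]

theorem eulerMascheroniConstant_bounds :
    0.57721566490 < Real.eulerMascheroniConstant ∧
      Real.eulerMascheroniConstant < 0.57721566494 := by
  -- at `m = 128` the enclosure has width `1 / (120 * 128 ^ 4) < 4e-11`, and `log m = 7 log 2`
  have hlo := monotone_gammaLower.ge_of_tendsto tendsto_gammaLower 127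
  have hup := antitone_gammaUpper.le_of_tendsto tendsto_gammaUpper 127
  have hlog : Real.log ((127 + 1 : ℕ) : ℝ) = 7 * Real.log 2 := by
    rw [show ((127 + 1 : ℕ) : ℝ) = 2 ^ 7 by norm_num, Real.log_pow]
    norm_num
  rw [gammaLower] at hlo
  rw [gammaUpper, hlog] at hlo hup
  simp only [harmonic, Finset.sum_range_succ, Finset.sum_range_zero] at hlo hup
  norm_num at hlo hup
  obtain ⟨h1, h2⟩ := log_two_bounds
  constructor <;> linarith

theorem exp_one_mul_deriv_kurepa_bounds :
    3.893138823 < Real.exp 1 * deriv kurepa 0 ∧ Real.exp 1 * deriv kurepa 0 < 3.893138824 := by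
  -- with 14 terms the truncation error is below `1e-12`
  have h := abs_exp_mul_deriv_kurepa_sub_le (N := 14) (by norm_num)
  simp only [laplacePartialSum, Finset.sum_range_succ, Finset.sum_range_zero, Real.log_one,
    add_zero, one_pow, mul_one, Nat.factorial] at h
  rw [laplaceConst, abs_le] at h
  norm_num at h
  obtain ⟨g1, g2⟩ := eulerMascheroniConstant_bounds
  have p1 := Real.pi_gt_d20
  have p2 := Real.pi_lt_d20
  have q1 : 0.57721566490 ^ 2 < Real.eulerMascheroniConstant ^ 2 := by gcongr
  have q2 : Real.eulerMascheroniConstant ^ 2 < 0.57721566494 ^ 2 := by gcongr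
  have r1 : 3.14159265358979323846 ^ 2 < Real.pi ^ 2 := by gcongr
  have r2 : Real.pi ^ 2 < 3.14159265358979323847 ^ 2 := by gcongr
  norm_num at q1 q2 r1 r2
  constructor <;> linarith [h.1, h.2]

/-- The value is `1.43220573465…`, so the ninth decimal place is decided by a margin of about
`1.5e-10`. -/
theorem deriv_kurepa_zero_bounds :
    1.4322057345 < deriv kurepa 0 ∧ deriv kurepa 0 < 1.4322057355 := by
  obtain ⟨h1, h2⟩ := exp_one_mul_deriv_kurepa_bounds
  obtain ⟨e1, e2⟩ := abs_le.mp Real.exp_one_near_20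
  norm_num at h1 h2 e1 e2
  have he := Real.exp_pos 1
  constructor
  · by_contra! hc
    nlinarith
  · by_contra! hc
    nlinarith

/-! ### The linear bound and its constant -/

theorem mainTheorem1 :
    (∀ x : ℝ, -1 < x →
      MeasureTheory.IntegrableOn (kurepaIntegrand x) (Set.Ioi (0 : ℝ)) MeasureTheory.volume) ∧
    DifferentiableAt ℝ kurepa 0 ∧
    (∀ x ∈ Set.Icc (0 : ℝ) 1, kurepa x ≤ deriv kurepa 0 * x) ∧
    (∀ c : ℝ, (∀ x ∈ Set.Icc (0 : ℝ) 1, kurepa x ≤ c * x) → deriv kurepa 0 ≤ c) ∧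
    |deriv kurepa 0 - 1.432205735| < 5 * (10 : ℝ) ^ (-10 : ℤ) := by
  obtain ⟨h1, h2⟩ := deriv_kurepa_zero_bounds
  refine ⟨fun x hx => integrableOn_kurepaIntegrand hx, hasDerivAt_kurepa_zero.differentiableAt,
    fun x hx => ?_, fun c hc => ?_, ?_⟩
  -- `kurepa_le` suffices since `1 ≤ K'(0)`
  · have := mul_nonneg (show 0 ≤ deriv kurepa 0 - 1 by linarith) (sq_nonneg x)
    linarith [kurepa_le hx]
  -- for small `x > 0` the slopes `K(x) / x` are at most `c`
  · have hslope := hasDerivAt_kurepa_zero.differentiableAt.hasDerivAt.hasDerivWithinAt (s := Ioi 0)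
    rw [hasDerivWithinAt_iff_tendsto_slope' (by simp)] at hslope
    refine le_of_tendsto hslope ?_
    filter_upwards [Ioo_mem_nhdsGT (show (0 : ℝ) < 1 by norm_num)] with x hx
    rw [slope_def_field, kurepa_zero, sub_zero, sub_zero, div_le_iff₀ hx.1]
    exact hc x ⟨hx.1.le, hx.2.le⟩
  · rw [abs_lt]
    norm_num
    constructor <;> linarith
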